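/- **Notation.** Let $X=\{x_0,x_1\}$ and $Y=\{y_s\}_{s\ge 1}$ be alphabets, and let $\mathbb C\langle\langle X\rangle\rangle$, $\mathbb C\langle\langle Y\rangle\rangle$ be the spaces of noncommutative formal power series. The shuffle product ⧢ (on $X$) and the stuffle product $\star$ (on $Y$) are the bilinear extensions to series of the products of words defined by $u ⧢ 1=1 ⧢ u=u$, $au ⧢ bv=a(u ⧢ bv)+b(au ⧢ v)$, and $u\star 1=1\star u=u$, $y_su\star y_tv=y_s(u\star y_tv)+y_t(y_su\star v)+y_{s+t}(u\star v)$. Let $\pi_X:\mathbb C\langle\langle Y\rangle\rangle\to\mathbb C\langle\langle X\rangle\rangle x_1\oplus\mathbb C1_{X^*}$ be the bijection induced by $y_{s_1}\cdots y_{s_r}\mapsto x_0^{s_1-1}x_1\cdots x_0^{s_r-1}x_1$, and $\pi_Y$ its inverse. For $|z|<1$ and $w=x_0^{s_1-1}x_1\cdots x_0^{s_r-1}x_1$ put $$\operatorname{Li}_w(z)=\sum_{n_1>\cdots>n_r>0}\frac{z^{n_1}}{n_1^{s_1}\cdots n_r^{s_r}},\qquad \operatorname{Li}_{1_{X^*}}(z)=1.$$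 For $S\in\mathbb C\langle\langle X\rangle\rangle x_1\oplus\mathbb C1_{X^*}$ with homogeneous components $[S]_n=\sum_{|w|=n}\langle S|w\rangle w$ (by length) put $\operatorname{Li}_{[S]_n}=\sum_{|w|=n}\langle S|w\rangle\operatorname{Li}_w$. For $0<R\le 1$ let $\mathrm{Dom}_R(\operatorname{Li})$ be the set of those $S$ for which $\sum_n\operatorname{Li}_{[S]_n}$ converges unconditionally in $\mathcal H(\{|z|<R\})$ (topology of compact convergence), with sum $\operatorname{Li}_S$. Let $\mathrm{Dom}^{\mathrm{loc}}(\operatorname{Li})=\bigcup_{0<R\le1}\mathrm{Dom}_R(\operatorname{Li})$ and $\mathrm{Dom}(\mathrm H)=\pi_Y(\mathrm{Dom}^{\mathrm{loc}}(\operatorname{Li}))$. For $S\in\mathrm{Dom}_R(\operatorname{Li})$, the numbers $\mathrm H_{\pi_Y(S)}(N)$ are defined by $\frac{\operatorname{Li}_S(z)}{1-z}=\sum_{N\ge0}\mathrm H_{\pi_Y(S)}(N)z^N$, $|z|<R$. The Hadamard product of power series is $\bigl(\sum a_Nz^N\bigr)\odot\bigl(\sum b_Nz^N\bigr)=\sum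 a_Nb_Nz^N$. **Theorem.** One has $1_{X^*}\in\mathrm{Dom}^{\mathrm{loc}}(\operatorname{Li})$ and $\operatorname{Li}_{1_{X^*}}=1$. Let $S,T\in\mathrm{Dom}^{\mathrm{loc}}(\operatorname{Li})$. Then $S ⧢ T$ and $\pi_X(\pi_Y(S)\star\pi_Y(T))$ lie in $\mathrm{Dom}^{\mathrm{loc}}(\operatorname{Li})$, and for all $N\ge0$ $$\mathrm H_{\pi_Y(S)\star\pi_Y(T)}(N)=\mathrm H_{\pi_Y(S)}(N)\,\mathrm H_{\pi_Y(T)}(N).$$ If moreover $S\in\mathrm{Dom}_{R_1}(\operatorname{Li})$ and $T\in\mathrm{Dom}_{R_2}(\operatorname{Li})$ with $0<R_1,R_2\le1$, then $$\operatorname{Li}_{S ⧢ T}(z)=\operatorname{Li}_S(z)\operatorname{Li}_T(z)\quad(|z|<\min(R_1,R_2)),$$ and, for $|z|<R_1R_2$, the Hadamard product of the Taylor series at $0$ of the left-hand factors converges and $$\frac{\operatorname{Li}_S(z)}{1-z}\odot\frac{\operatorname{Li}_T(z)}{1-z}=\frac{\operatorname{Li}_{\pi_X(\pi_Y(S)\star\pi_Y(T))}(z)}{1-z}.$$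 Consequently $\mathrm{Dom}(\mathrm H)$ is a unital stuffle subalgebra of $\mathbb C\langle\langle Y\rangle\rangle$ (a linear subspace containing $1_{Y^*}$ and closed under $\star$), and $\mathrm H:\mathrm{Dom}(\mathrm H)\to\mathbb C^{\mathbb N}$ is a stuffle character: linear, with $\mathrm H_{1_{Y^*}}=1$ and $\mathrm H_{P\star Q}=\mathrm H_P\mathrm H_Q$. -/

import Mathlib

open Filter Topology

noncomputable section

namespace LocalPolylog

/-- The alphabet `X = {x₀, x₁}`. -/
inductive X where
  | x0 : X
  | x1 : X
  deriving DecidableEq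

instance : Fintype X := ⟨{X.x0, X.x1}, fun a => by cases a <;> decide⟩

/-- Noncommutative formal power series `ℂ⟨⟨A⟩⟩` over an alphabet `A`: a series is its family of
coefficients, indexed by the words (lists of letters). -/
abbrev NCSeries (A : Type) : Type := List A → ℂ

/-- The series `1_{A^*}` (the empty word). -/
def emptyWord (A : Type) [DecidableEq A] : NCSeries A := Pi.single [] 1

/-! ### Shuffle and stuffle -/

/-- The shuffle product of two words, as a multiset of words (a polynomial with coefficients
in `ℕ`). -/
def shuffleWord {A : Type} : List A → List A → Multiset (List A)
  | [], v => {v}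
  | a :: u, [] => {a :: u}
  | a :: u, b :: v =>
      (shuffleWord u (b :: v)).map (List.cons a) + (shuffleWord (a :: u) v).map (List.cons b)
  termination_by u v => u.length + v.length

/-- The stuffle product of two words over `Y = {y_s : s ≥ 1}`, the letter `y_s` being coded by
`s : ℕ+`. -/
def stuffleWord : List ℕ+ → List ℕ+ → Multiset (List ℕ+)
  | [], v => {v}
  | s :: u, [] => {s :: u}
  | s :: u, t :: v =>
      (stuffleWord u (t :: v)).map (List.cons s) + (stuffleWord (s :: u) v).map (List.cons t)
        + (stuffleWord u v).map (List.cons (s + t))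
  termination_by u v => u.length + v.length

/-- The weight `s₁ + ⋯ + s_r` of the word `y_{s₁} ⋯ y_{s_r}`. -/
def weight (s : List ℕ+) : ℕ := (s.map (fun k : ℕ+ => (k : ℕ))).sum

/-- The bilinear extension to series of a product of words:
`⟨S * T | w⟩ = ∑_{u, v} ⟨S | u⟩ ⟨T | v⟩ ⟨u * v | w⟩`. -/
def extendProduct {A : Type} [DecidableEq A] (p : List A → List A → Multiset (List A))
    (S T : NCSeries A) : NCSeries A :=
  fun w => ∑ᶠ q : List A × List A, S q.1 * T q.2 * ((p q.1 q.2).count w : ℂ)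

/-- The shuffle product on `ℂ⟨⟨X⟩⟩`. -/
def shuffle (S T : NCSeries X) : NCSeries X := extendProduct shuffleWord S T

/-- The stuffle product on `ℂ⟨⟨Y⟩⟩`. -/
def stuffle (P Q : NCSeries ℕ+) : NCSeries ℕ+ := extendProduct stuffleWord P Q

theorem length_of_mem_shuffleWord {A : Type} (u v w : List A) (h : w ∈ shuffleWord u v) :
    w.length = u.length + v.length := by
  induction u, v using shuffleWord.induct generalizing w with
  | case1 v => simp_all [shuffleWord]
  | case2 a u => simp_all [shuffleWord]
  | case3 a u b v ih1 ih2 =>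
    simp only [shuffleWord, Multiset.mem_add, Multiset.mem_map] at h
    rcases h with ⟨x, hx, rfl⟩ | ⟨x, hx, rfl⟩
    · have := ih1 x hx; simp at this ⊢; omega
    · have := ih2 x hx; simp at this ⊢; omega

theorem weight_of_mem_stuffleWord (u v w : List ℕ+) (h : w ∈ stuffleWord u v) :
    weight w = weight u + weight v := by
  induction u, v using stuffleWord.induct generalizing w with
  | case1 v => simp_all [stuffleWord, weight]
  | case2 a u => simp_all [stuffleWord, weight]
  | case3 a u b v ih1 ih2 ih3 =>
    simp only [stuffleWord, Multiset.mem_add, Multiset.mem_map] at h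
    rcases h with (⟨x, hx, rfl⟩ | ⟨x, hx, rfl⟩) | ⟨x, hx, rfl⟩
    · have := ih1 x hx; simp [weight] at this ⊢; omega
    · have := ih2 x hx; simp [weight] at this ⊢; omega
    · have := ih3 x hx; simp [weight] at this ⊢; omega

theorem finite_weight_le (n : ℕ) : {s : List ℕ+ | weight s ≤ n}.Finite := by
  induction n with
  | zero =>
    refine (Set.finite_singleton ([] : List ℕ+)).subset ?_
    rintro (_ | ⟨a, l⟩) h
    · simp
    · have := a.pos
      simp [weight] at h
  | succ n ih =>
    have hf : {k : ℕ+ | (k : ℕ) ≤ n + 1}.Finite :=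
      (Set.finite_Iic (n + 1)).preimage (fun _ _ _ _ h => PNat.eq h)
    refine ((Set.finite_singleton ([] : List ℕ+)).union
      (Set.Finite.image2 List.cons hf ih)).subset ?_
    rintro (_ | ⟨a, l⟩) h
    · simp
    · have := a.pos
      simp only [weight, List.map_cons, List.sum_cons, Set.mem_ofPred_eq] at h
      exact Or.inr ⟨a, by simp; omega, l, by simp [weight]; omega, rfl⟩

/-- The sum that defines a coefficient of the shuffle product is finite. -/
theorem shuffle_support_finite (S T : NCSeries X) (w : List X) :
    (Function.support fun q : List X × List X =>
      S q.1 * T q.2 * ((shuffleWord q.1 q.2).count w : ℂ)).Finite := by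
  have hf : {u : List X | u.length ≤ w.length}.Finite := List.finite_length_le X w.length
  refine (hf.prod hf).subset ?_
  intro q hq
  have h : w ∈ shuffleWord q.1 q.2 := by
    by_contra h
    exact hq (by simp [Multiset.count_eq_zero_of_notMem h])
  have := length_of_mem_shuffleWord _ _ _ h
  constructor <;> simp <;> omega

/-- The sum that defines a coefficient of the stuffle product is finite. -/
theorem stuffle_support_finite (P Q : NCSeries ℕ+) (w : List ℕ+) :
    (Function.support fun q : List ℕ+ × List ℕ+ =>
      P q.1 * Q q.2 * ((stuffleWord q.1 q.2).count w : ℂ)).Finite := by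
  have hf := finite_weight_le (weight w)
  refine (hf.prod hf).subset ?_
  intro q hq
  have h : w ∈ stuffleWord q.1 q.2 := by
    by_contra h
    exact hq (by simp [Multiset.count_eq_zero_of_notMem h])
  have := weight_of_mem_stuffleWord _ _ _ h
  constructor <;> simp <;> omega

/-! ### The correspondence between the alphabets -/

/-- The concatenation morphism `π_X` on words: `y_s ↦ x₀^{s-1} x₁`. -/
def piXWord : List ℕ+ → List X
  | [] => []
  | s :: l => List.replicate (s.natPred) X.x0 ++ X.x1 :: piXWord l

theorem replicate_append_x1_inj (m n : ℕ) (u v : List X)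
    (h : List.replicate m X.x0 ++ X.x1 :: u = List.replicate n X.x0 ++ X.x1 :: v) :
    m = n ∧ u = v := by
  induction m generalizing n with
  | zero =>
    cases n with
    | zero => simpa using h
    | succ n => simp [List.replicate_succ] at h
  | succ m ih =>
    cases n with
    | zero => simp [List.replicate_succ] at h
    | succ n =>
      simp only [List.replicate_succ, List.cons_append, List.cons.injEq, true_and] at h
      have := ih n h
      exact ⟨by omega, this.2⟩

theorem piXWord_injective : Function.Injective piXWord := by
  intro a
  induction a with
  | nil =>
    rintro (_ | ⟨t, v⟩) h
    · rfl
    · simp [piXWord] at h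
  | cons s u ih =>
    rintro (_ | ⟨t, v⟩) h
    · simp [piXWord] at h
    · obtain ⟨h1, h2⟩ := replicate_append_x1_inj _ _ _ _ h
      rw [PNat.natPred_inj] at h1
      rw [h1, ih h2]

/-- `π_X : ℂ⟨⟨Y⟩⟩ → ℂ⟨⟨X⟩⟩`, `∑ ⟨Q | v⟩ v ↦ ∑ ⟨Q | v⟩ π_X(v)`: the coefficient of `π_X(v)` is
that of `v`, and the words outside the image of `π_X` have coefficient `0`. -/
def piX (Q : NCSeries ℕ+) : NCSeries X := Function.extend piXWord Q 0

/-- `π_Y`, the inverse of `π_X` on its image: the coefficient of `v` is that of `π_X(v)`. -/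
def piY (S : NCSeries X) : NCSeries ℕ+ := fun v => S (piXWord v)

/-- The subspace `ℂ⟨⟨X⟩⟩ x₁ ⊕ ℂ 1_{X^*}`. -/
def endsInX1 : Set (NCSeries X) :=
  {S | ∀ w, S w ≠ 0 → w = [] ∨ ∃ u, w = u ++ [X.x1]}

/-- `X^* x₁ ∪ {1_{X^*}}` is exactly the image of `π_X` on words. -/
theorem mem_range_piXWord (w : List X) :
    w ∈ Set.range piXWord ↔ w = [] ∨ ∃ u, w = u ++ [X.x1] := by
  constructor
  · rintro ⟨s, rfl⟩
    induction s with
    | nil => exact Or.inl rfl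
    | cons s l ih =>
      right
      rcases ih with h | ⟨u, h⟩
      · exact ⟨List.replicate s.natPred X.x0, by simp [piXWord, h]⟩
      · exact ⟨List.replicate s.natPred X.x0 ++ X.x1 :: u, by simp [piXWord, h]⟩
  · rintro (rfl | ⟨u, rfl⟩)
    · exact ⟨[], rfl⟩
    · induction u with
      | nil => exact ⟨[1], rfl⟩
      | cons a u ih =>
        obtain ⟨s, hs⟩ := ih
        cases a with
        | x1 => exact ⟨1 :: s, by simp [piXWord, hs, PNat.natPred]⟩
        | x0 =>
          cases s with
          | nil => simp [piXWord] at hs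
          | cons t l =>
            refine ⟨(t + 1) :: l, ?_⟩
            have ht : (t + 1).natPred = t.natPred + 1 := by
              have := t.pos
              simp only [PNat.natPred, PNat.add_coe, PNat.one_coe]
              omega
            simp only [piXWord, ht, List.replicate_succ, List.cons_append] at hs ⊢
            rw [hs]

/-- `π_X` and `π_Y` are mutually inverse bijections between `ℂ⟨⟨Y⟩⟩` and
`ℂ⟨⟨X⟩⟩ x₁ ⊕ ℂ 1_{X^*}`. -/
theorem piY_piX (Q : NCSeries ℕ+) : piY (piX Q) = Q := by
  funext v
  exact piXWord_injective.extend_apply Q 0 v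

theorem piX_piY (S : NCSeries X) (hS : S ∈ endsInX1) : piX (piY S) = S := by
  funext w
  by_cases h : ∃ s, piXWord s = w
  · obtain ⟨s, rfl⟩ := h
    exact piXWord_injective.extend_apply _ _ _
  · rw [piX, Function.extend_apply' _ _ _ h]
    by_contra h0
    exact h ((mem_range_piXWord w).2 (hS w (Ne.symm h0)))

/-! ### Polylogarithms near zero -/

/-- The harmonic sums `H_{s₁,…,s_r}(N) = ∑_{N ≥ n₁ > ⋯ > n_r > 0} 1 / (n₁^{s₁} ⋯ n_r^{s_r})`
(the outer index is `n₁ = n + 1`). -/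
def harmonicSum : List ℕ+ → ℕ → ℂ
  | [], _ => 1
  | s :: l, N => ∑ n ∈ Finset.range N, 1 / ((n : ℂ) + 1) ^ (s : ℕ) * harmonicSum l n

/-- The polylogarithms
`Li_{s₁,…,s_r}(z) = ∑_{n₁ > ⋯ > n_r > 0} z^{n₁} / (n₁^{s₁} ⋯ n_r^{s_r})` for `|z| < 1`
(summed first over `n₂, …, n_r`, with `n₁ = n + 1`), and `Li = 1` for the empty list. -/
def polylog : List ℕ+ → ℂ → ℂ
  | [], _ => 1
  | s :: l, z => ∑' n : ℕ, z ^ (n + 1) / ((n : ℂ) + 1) ^ (s : ℕ) * harmonicSum l n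

/-- `Li_w` for `w ∈ X^* x₁ ∪ {1_{X^*}}`, the word `x₀^{s₁-1} x₁ ⋯ x₀^{s_r-1} x₁` coding the list
`(s₁,…,s_r)`. The other words (singular at zero) never occur in the series considered below, and
get the dummy value `0`. -/
def LiWord : List X → ℂ → ℂ := Function.extend piXWord polylog 0

/-- `Li_{[S]_n} = ∑_{|w| = n} ⟨S | w⟩ Li_w`, where `[S]_n` is the homogeneous component of
degree `n` of `S` with respect to the length of words. -/
def LiComponent (S : NCSeries X) (n : ℕ) (z : ℂ) : ℂ :=
  ∑ w : Fin n → X, S (List.ofFn w) * LiWord (List.ofFn w) z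

/-- `Li_S(z) = ∑_n Li_{[S]_n}(z)`. -/
def Li (S : NCSeries X) (z : ℂ) : ℂ := ∑' n : ℕ, LiComponent S n z

/-- `Dom_R(Li)`: the series `S` in `ℂ⟨⟨X⟩⟩ x₁ ⊕ ℂ 1_{X^*}` such that `∑_n Li_{[S]_n}` converges
unconditionally (the net of the finite partial sums converges) for the topology of compact
convergence on the open disk `|z| < R`. -/
def DomR (R : ℝ) : Set (NCSeries X) :=
  {S | S ∈ endsInX1 ∧ SummableLocallyUniformlyOn (LiComponent S) (Metric.ball (0 : ℂ) R)}

/-- `Dom^loc(Li)`, the union of the `Dom_R(Li)` for `0 < R ≤ 1`. -/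
def DomLoc : Set (NCSeries X) := {S | ∃ R : ℝ, 0 < R ∧ R ≤ 1 ∧ S ∈ DomR R}

/-- `Dom(H) = π_Y(Dom^loc(Li))`. -/
def DomH : Set (NCSeries ℕ+) := piY '' DomLoc

/-- The `N`-th Taylor coefficient at zero. -/
def taylorCoeff (f : ℂ → ℂ) (N : ℕ) : ℂ := iteratedDeriv N f 0 / (N.factorial : ℂ)

/-- `H_Q(N)` for a series `Q` in `Dom(H)`, that is `Q = π_Y(S)` with `S = π_X(Q)` in
`Dom^loc(Li)`: the `N`-th Taylor coefficient at zero of `Li_S(z) / (1 - z)`. -/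
def H (Q : NCSeries ℕ+) (N : ℕ) : ℂ := taylorCoeff (fun z => Li (piX Q) z / (1 - z)) N

end LocalPolylog

end

open LocalPolylog

/-!
For words the two multiplicativity statements are classical. The harmonic sums multiply by the
stuffle product because a product of two nested sums splits according to the order of the outer
indices (`sum_harmonicSum_stuffleWord`). The polylogarithms multiply by the shuffle product because
of their differential equations and the Leibniz rule, which is checked here on formal power series
by means of the Euler operator `z d/dz` (`sum_liSeries_shuffleWord`); the formal identity is then
evaluated on the unit disk (`sum_LiWord_shuffleWord`). Both products are homogeneous, for the length
over `X` and the weight over `Y`, so the homogeneous components of a product of series are the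
Cauchy products of those of the factors (`gradedSum_extendProduct`).

Passing to infinite sums requires absolute convergence, while the domains are defined by
unconditional convergence. For holomorphic functions on a disk this is no loss:
`summableLocallyUniformlyOn_ball_iff` shows that unconditional convergence in the topology of
compact convergence is normal convergence. Shuffle products are then handled by Cauchy products of
normally convergent series. For stuffle products, normal convergence is rewritten as a bound
`|h n N| r ^ N ≤ u n` with `∑ u n < ∞`, where `h n N` is the `N`-th Taylor coefficient of
`Li_{[S]_n}(z) / (1 - z)`, a combination of harmonic sums of weight `n`
(`piX_mem_DomR_iff`). Bounds of this kind for `r₁` and `r₂` multiply to one for `r₁ r₂`, which gives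
the disk of radius `R₁ R₂` for the Hadamard product (`piX_stuffle_mem_DomR`). Finally `H_Q(N)` is
the absolutely convergent sum over `n` of the `h n N` (`H_eq_tsum_harmonicComponent`), whence its
linearity and multiplicativity.
-/

noncomputable section

namespace LocalPolylog

/-! ### Power series and normal convergence on a disk -/

theorem hasSum_taylorCoeff {f : ℂ → ℂ} {R : ℝ} (hf : DifferentiableOn ℂ f (Metric.ball 0 R))
    {z : ℂ} (hz : ‖z‖ < R) : HasSum (fun k => taylorCoeff f k * z ^ k) (f z) := by
  have h := Complex.hasSum_taylorSeries_on_ball hf (mem_ball_zero_iff.2 hz)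
  refine h.congr_fun fun k => ?_
  simp only [taylorCoeff, sub_zero, smul_eq_mul]
  ring

theorem hasFPowerSeriesOnBall_of_hasSum {f : ℂ → ℂ} {c : ℕ → ℂ} {R : ℝ} (hR : 0 < R)
    (h : ∀ z : ℂ, ‖z‖ < R → HasSum (fun k => c k * z ^ k) (f z)) :
    HasFPowerSeriesOnBall f (FormalMultilinearSeries.ofScalars ℂ c) 0 (ENNReal.ofReal R) := by
  refine ⟨?_, by simpa using hR, ?_⟩
  · refine ENNReal.le_of_forall_nnreal_lt fun r hr => ?_
    refine FormalMultilinearSeries.le_radius_of_tendsto (l := 0) _ ?_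
    have hr' : (r : ℝ) < R := by
      have := (ENNReal.lt_ofReal_iff_toReal_lt (by simp)).1 hr
      simpa using this
    have := (h (r : ℝ) (by simpa using hr')).summable.tendsto_atTop_zero.norm
    refine (this.congr fun k => ?_).trans (by simp)
    simp
  · intro y hy
    have hy' : ‖y‖ < R := by
      simpa [Metric.eball_ofReal] using hy
    have := h y hy'
    simpa [FormalMultilinearSeries.ofScalars_apply_eq, mul_comm] using this

theorem differentiableOn_of_hasSum {f : ℂ → ℂ} {c : ℕ → ℂ} {R : ℝ}
    (h : ∀ z : ℂ, ‖z‖ < R → HasSum (fun k => c k * z ^ k) (f z)) :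
    DifferentiableOn ℂ f (Metric.ball 0 R) := by
  rcases le_or_gt R 0 with hR | hR
  · rw [Metric.ball_eq_empty.2 hR]
    exact differentiableOn_empty
  · simpa [Metric.eball_ofReal] using (hasFPowerSeriesOnBall_of_hasSum hR h).differentiableOn

theorem taylorCoeff_eq_of_hasSum {f : ℂ → ℂ} {c : ℕ → ℂ} {R : ℝ} (hR : 0 < R)
    (h : ∀ z : ℂ, ‖z‖ < R → HasSum (fun k => c k * z ^ k) (f z)) (k : ℕ) :
    taylorCoeff f k = c k := by
  have h1 := (hasFPowerSeriesOnBall_of_hasSum hR h).hasFPowerSeriesAt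
  have h2 : HasFPowerSeriesAt f
      (FormalMultilinearSeries.ofScalars ℂ (taylorCoeff f)) 0 :=
    (hasFPowerSeriesOnBall_of_hasSum hR
      fun z hz => hasSum_taylorCoeff (differentiableOn_of_hasSum h) hz).hasFPowerSeriesAt
  have := h2.eq_formalMultilinearSeries h1
  exact congrFun (FormalMultilinearSeries.ofScalars_series_injective ℂ ℂ this) k

/-- Cauchy's estimate. -/
theorem norm_taylorCoeff_mul_pow_le {f : ℂ → ℂ} {R r M : ℝ}
    (hf : DifferentiableOn ℂ f (Metric.ball 0 R)) (hr : 0 < r) (hrR : r < R)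
    (hM : ∀ z : ℂ, ‖z‖ ≤ r → ‖f z‖ ≤ M) (k : ℕ) : ‖taylorCoeff f k‖ * r ^ k ≤ M := by
  have hd : DiffContOnCl ℂ f (Metric.ball 0 r) :=
    (hf.mono ((closure_minimal Metric.ball_subset_closedBall Metric.isClosed_closedBall).trans
      (Metric.closedBall_subset_ball hrR))).diffContOnCl
  have h := Complex.norm_iteratedDeriv_le_of_forall_mem_sphere_norm_le k hr hd
    (fun z hz => hM z (by simpa using (mem_sphere_zero_iff_norm.1 hz).le))
  have hk : (0 : ℝ) < k.factorial := by positivity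
  rw [taylorCoeff, norm_div, Complex.norm_natCast, div_mul_eq_mul_div, div_le_iff₀ hk]
  rw [le_div_iff₀ (by positivity)] at h
  linarith

/-- Unconditional convergence of complex series is absolute, in quantitative form. -/
theorem sum_norm_le_of_forall_norm_sum_le {ι : Type*} {a : ι → ℂ} {M : ℝ}
    (h : ∀ F : Finset ι, ‖∑ i ∈ F, a i‖ ≤ M) (F : Finset ι) : ∑ i ∈ F, ‖a i‖ ≤ 4 * M := by
  have key : ∀ x : ι → ℝ, (∀ F : Finset ι, |∑ i ∈ F, x i| ≤ M) → ∑ i ∈ F, |x i| ≤ 2 * M := by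
    intro x hx
    rw [← Finset.sum_filter_add_sum_filter_not F (fun i => 0 ≤ x i)]
    have h1 : ∑ i ∈ F with 0 ≤ x i, |x i| = ∑ i ∈ F with 0 ≤ x i, x i :=
      Finset.sum_congr rfl fun i hi => abs_of_nonneg (Finset.mem_filter.1 hi).2
    have h2 : ∑ i ∈ F with ¬ 0 ≤ x i, |x i| = -∑ i ∈ F with ¬ 0 ≤ x i, x i := by
      rw [← Finset.sum_neg_distrib]
      exact Finset.sum_congr rfl fun i hi =>
        abs_of_neg (not_le.1 (Finset.mem_filter.1 hi).2)
    rw [h1, h2]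
    linarith [(abs_le.1 (hx (F.filter fun i => 0 ≤ x i))).2,
      (abs_le.1 (hx (F.filter fun i => ¬ 0 ≤ x i))).1]
  have hre := key (fun i => (a i).re) fun F => by
    simpa using (Complex.abs_re_le_norm (∑ i ∈ F, a i)).trans (h F)
  have him := key (fun i => (a i).im) fun F => by
    simpa using (Complex.abs_im_le_norm (∑ i ∈ F, a i)).trans (h F)
  calc ∑ i ∈ F, ‖a i‖ ≤ ∑ i ∈ F, (|(a i).re| + |(a i).im|) :=
        Finset.sum_le_sum fun i _ => Complex.norm_le_abs_re_add_abs_im _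
    _ ≤ 4 * M := by rw [Finset.sum_add_distrib]; linarith

/-- On a compact set, the finite partial sums of an unconditionally convergent series of
continuous functions are uniformly bounded. -/
theorem exists_forall_norm_sum_le {ι : Type*} {f : ι → ℂ → ℂ} {U K : Set ℂ}
    (hf : ∀ n, ContinuousOn (f n) U) (hs : SummableLocallyUniformlyOn f U) (hK : IsCompact K)
    (hKU : K ⊆ U) : ∃ M : ℝ, ∀ F : Finset ι, ∀ z ∈ K, ‖∑ n ∈ F, f n z‖ ≤ M := by
  classical
  obtain ⟨g, hg⟩ := hs
  have ht : TendstoUniformlyOn (fun F z => ∑ n ∈ F, f n z) g atTop K :=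
    (tendstoLocallyUniformlyOn_iff_tendstoUniformlyOn_of_compact hK).1 (hg.mono hKU)
  have h1 := (Metric.tendstoUniformlyOn_iff.1 ht) 1 one_pos
  obtain ⟨F₀, hF₀⟩ := Filter.eventually_atTop.1 h1
  have hb : ∀ n, ∃ C : ℝ, ∀ z ∈ K, ‖f n z‖ ≤ C := fun n =>
    hK.exists_bound_of_continuousOn ((hf n).mono hKU)
  choose C hC using hb
  have hC0 : ∀ n, ∀ z ∈ K, 0 ≤ C n := fun n z hz => (norm_nonneg _).trans (hC n z hz)
  refine ⟨2 + 2 * ∑ n ∈ F₀, C n, fun F z hz => ?_⟩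
  have hsmall : ∀ G ⊆ F₀, ‖∑ n ∈ G, f n z‖ ≤ ∑ n ∈ F₀, C n := fun G hG =>
    (norm_sum_le _ _).trans ((Finset.sum_le_sum fun n _ => hC n z hz).trans
      (Finset.sum_le_sum_of_subset_of_nonneg hG fun n _ _ => hC0 n z hz))
  -- The sums over `F ∪ F₀` and over `F₀` are both within `1` of the limit `g z`.
  have e : ∑ n ∈ F, f n z = (∑ n ∈ F ∪ F₀, f n z - ∑ n ∈ F₀, f n z)
      + ∑ n ∈ F ∩ F₀, f n z := by
    linear_combination -(Finset.sum_union_inter (s₁ := F) (s₂ := F₀) (f := fun n => f n z))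
  have d1 := hF₀ (F ∪ F₀) Finset.subset_union_right z hz
  have d2 := hF₀ F₀ le_rfl z hz
  have d3 := hsmall (F ∩ F₀) Finset.inter_subset_right
  have d4 : ‖∑ n ∈ F ∪ F₀, f n z - ∑ n ∈ F₀, f n z‖ < 2 := by
    rw [← dist_eq_norm]
    have := dist_triangle_left (∑ n ∈ F ∪ F₀, f n z) (∑ n ∈ F₀, f n z) (g z)
    linarith
  rw [e]
  refine (norm_add_le _ _).trans ?_
  have : 0 ≤ ∑ n ∈ F₀, C n := (norm_nonneg _).trans (hsmall _ le_rfl)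
  linarith

/-- For holomorphic functions on a disk centred at `0`, unconditional convergence in the topology
of compact convergence is the same as normal convergence. The direct implication reflects the
nuclearity of the space of holomorphic functions: each Taylor coefficient of the partial sums is
bounded by Cauchy's estimate on a slightly larger circle, unconditional convergence is absolute
for scalars, and the coefficients are then summed along a geometric series. -/
theorem summableLocallyUniformlyOn_ball_iff {f : ℕ → ℂ → ℂ} {R : ℝ}
    (hf : ∀ n, DifferentiableOn ℂ (f n) (Metric.ball 0 R)) :
    SummableLocallyUniformlyOn f (Metric.ball 0 R) ↔
      ∀ r, 0 < r → r < R → ∃ u : ℕ → ℝ, Summable u ∧ ∀ n, ∀ z : ℂ, ‖z‖ ≤ r → ‖f n z‖ ≤ u n := by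
  constructor
  · intro hs r hr hrR
    obtain ⟨ρ, hrρ, hρR⟩ := exists_between hrR
    have hρ : 0 < ρ := hr.trans hrρ
    obtain ⟨M, hM⟩ := exists_forall_norm_sum_le (fun n => (hf n).continuousOn) hs
      (isCompact_closedBall (0 : ℂ) ρ) (Metric.closedBall_subset_ball hρR)
    set q : ℝ := r / ρ with hq
    have hq0 : 0 ≤ q := by positivity
    have hq1 : q < 1 := (div_lt_one hρ).2 hrρ
    have hcoef : ∀ (F : Finset ℕ) (k : ℕ),
        ∑ n ∈ F, ‖taylorCoeff (f n) k‖ * r ^ k ≤ 4 * M * q ^ k := by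
      intro F k
      have h1 : ∀ G : Finset ℕ, ‖∑ n ∈ G, taylorCoeff (f n) k * (ρ : ℂ) ^ k‖ ≤ M := by
        intro G
        have h2 : taylorCoeff (fun z => ∑ n ∈ G, f n z) k = ∑ n ∈ G, taylorCoeff (f n) k :=
          taylorCoeff_eq_of_hasSum (hρ.trans hρR) (c := fun k => ∑ n ∈ G, taylorCoeff (f n) k)
            (fun z hz => by
              simp_rw [Finset.sum_mul]
              exact hasSum_sum fun n _ => hasSum_taylorCoeff (hf n) hz) k
        have h3 := norm_taylorCoeff_mul_pow_le (f := fun z => ∑ n ∈ G, f n z) (M := M)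
          (DifferentiableOn.fun_sum fun n _ => hf n) hρ hρR
          (fun z hz => hM G z (by simpa using hz)) k
        rw [h2] at h3
        rw [← Finset.sum_mul, norm_mul, norm_pow, Complex.norm_real, Real.norm_of_nonneg hρ.le]
        exact h3
      have h4 := sum_norm_le_of_forall_norm_sum_le h1 F
      have h5 : ∀ n, ‖taylorCoeff (f n) k‖ * r ^ k
          = ‖taylorCoeff (f n) k * (ρ : ℂ) ^ k‖ * q ^ k := by
        intro n
        rw [norm_mul, norm_pow, Complex.norm_real, Real.norm_of_nonneg hρ.le, hq, div_pow]
        field_simp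
      simp_rw [h5, ← Finset.sum_mul]
      exact mul_le_mul_of_nonneg_right h4 (by positivity)
    have hsum : ∀ n, Summable fun k => ‖taylorCoeff (f n) k‖ * r ^ k := by
      intro n
      refine Summable.of_nonneg_of_le (fun k => by positivity) (fun k => ?_)
        ((summable_geometric_of_lt_one hq0 hq1).mul_left (4 * M))
      simpa using hcoef {n} k
    refine ⟨fun n => ∑' k, ‖taylorCoeff (f n) k‖ * r ^ k, ?_, fun n z hz => ?_⟩
    · refine summable_of_sum_le (c := ∑' k, 4 * M * q ^ k)
        (fun n => tsum_nonneg fun k => by positivity) fun F => ?_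
      rw [← Summable.tsum_finsetSum fun n _ => hsum n]
      exact Summable.tsum_le_tsum (hcoef F) (summable_sum fun n _ => hsum n)
        ((summable_geometric_of_lt_one hq0 hq1).mul_left (4 * M))
    · have h1 := hasSum_taylorCoeff (hf n) (hz.trans_lt hrR)
      rw [← h1.tsum_eq]
      refine tsum_of_norm_bounded (hsum n).hasSum fun k => ?_
      rw [norm_mul, norm_pow]
      gcongr
  · intro h
    refine SummableLocallyUniformlyOn_of_locally_bounded Metric.isOpen_ball fun K hKR hK => ?_
    obtain ⟨r, hr, hrR⟩ : ∃ r < R, K ⊆ Metric.closedBall 0 r := by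
      rcases K.eq_empty_or_nonempty with rfl | hne
      · exact ⟨R - 1, by linarith, by simp⟩
      · obtain ⟨x, hx, hmax⟩ := hK.exists_isMaxOn hne continuous_norm.continuousOn
        exact ⟨‖x‖, by simpa using hKR hx, fun y hy => by simpa using hmax hy⟩
    rcases K.eq_empty_or_nonempty with rfl | ⟨x, hx⟩
    · exact ⟨0, summable_zero, by simp⟩
    · have hR : 0 < R := (norm_nonneg x).trans_lt (by simpa using hKR hx)
      obtain ⟨ρ, h1, h2⟩ := exists_between (max_lt hr hR)
      obtain ⟨u, hu, hb⟩ := h ρ ((le_max_right _ _).trans_lt h1) h2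
      refine ⟨u, hu, fun n z hz => hb n z ?_⟩
      have : ‖z‖ ≤ r := by simpa using hrR hz
      exact this.trans ((le_max_left _ _).trans h1.le)

/-- Normal convergence on the disk of radius `R ≤ 1` in terms of the Taylor coefficients
`h n N` of `f n z / (1 - z)`. -/
theorem summableLocallyUniformlyOn_ball_iff_coeff {f : ℕ → ℂ → ℂ} {h : ℕ → ℕ → ℂ} {R : ℝ}
    (hR : R ≤ 1) (hf : ∀ n, DifferentiableOn ℂ (f n) (Metric.ball 0 1))
    (hh : ∀ n, ∀ z : ℂ, ‖z‖ < 1 → HasSum (fun N => h n N * z ^ N) (f n z / (1 - z))) :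
    SummableLocallyUniformlyOn f (Metric.ball 0 R) ↔
      ∀ r, 0 < r → r < R → ∃ u : ℕ → ℝ, Summable u ∧ ∀ n N, ‖h n N‖ * r ^ N ≤ u n := by
  rw [summableLocallyUniformlyOn_ball_iff fun n => (hf n).mono (Metric.ball_subset_ball hR)]
  constructor
  · intro hs r hr hrR
    obtain ⟨u, hu, hb⟩ := hs r hr hrR
    have hr1 : r < 1 := hrR.trans_le hR
    refine ⟨fun n => u n / (1 - r), hu.div_const _, fun n N => ?_⟩
    rw [← taylorCoeff_eq_of_hasSum one_pos (hh n) N]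
    refine norm_taylorCoeff_mul_pow_le (differentiableOn_of_hasSum (hh n)) hr hr1
      (fun z hz => ?_) N
    have h1 : 1 - r ≤ ‖1 - z‖ := by
      have := norm_sub_norm_le (1 : ℂ) z
      rw [norm_one] at this
      linarith
    rw [norm_div]
    have := hb n z hz
    have h0 : 0 < 1 - r := by linarith
    exact div_le_div₀ ((norm_nonneg _).trans this) this h0 h1
  · intro hs r hr hrR
    obtain ⟨ρ, hrρ, hρR⟩ := exists_between hrR
    have hρ : 0 < ρ := hr.trans hrρ
    obtain ⟨u, hu, hb⟩ := hs ρ hρ hρR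
    set q : ℝ := r / ρ with hq
    have hq0 : 0 ≤ q := by positivity
    have hq1 : q < 1 := (div_lt_one hρ).2 hrρ
    refine ⟨fun n => 2 * (u n * (1 - q)⁻¹), (hu.mul_right _).mul_left _, fun n z hz => ?_⟩
    have hz1 : ‖z‖ < 1 := by linarith
    have hz0 : (1 : ℂ) - z ≠ 0 := by
      intro h0
      rw [sub_eq_zero] at h0
      simp [← h0] at hz1
    have h1 : ‖f n z / (1 - z)‖ ≤ u n * (1 - q)⁻¹ := by
      rw [← (hh n z hz1).tsum_eq]
      refine tsum_of_norm_bounded ((hasSum_geometric_of_lt_one hq0 hq1).mul_left (u n))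
        fun N => ?_
      rw [norm_mul, norm_pow]
      calc ‖h n N‖ * ‖z‖ ^ N ≤ ‖h n N‖ * r ^ N := by gcongr
        _ = ‖h n N‖ * ρ ^ N * q ^ N := by rw [hq, div_pow]; field_simp
        _ ≤ u n * q ^ N := by gcongr; exact hb n N
    have h2 : ‖1 - z‖ ≤ 2 := by
      have := norm_sub_le (1 : ℂ) z
      rw [norm_one] at this
      linarith
    calc ‖f n z‖ = ‖1 - z‖ * ‖f n z / (1 - z)‖ := by
          rw [← norm_mul, mul_div_cancel₀ _ hz0]
      _ ≤ 2 * (u n * (1 - q)⁻¹) := by gcongr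

/-- Interchange of the two summations in `∑ₙ fₙ(z) = (1 - z) ∑ₙ ∑_N h n N z^N`. -/
theorem hasSum_tsum_coeff {f : ℕ → ℂ → ℂ} {h : ℕ → ℕ → ℂ} {r : ℝ} {u : ℕ → ℝ}
    (hr1 : r < 1)
    (hh : ∀ n, ∀ z : ℂ, ‖z‖ < 1 → HasSum (fun N => h n N * z ^ N) (f n z / (1 - z)))
    (hu : Summable u) (hb : ∀ n N, ‖h n N‖ * r ^ N ≤ u n) {z : ℂ} (hz : ‖z‖ < r) :
    HasSum (fun N => (∑' n, h n N) * z ^ N) ((∑' n, f n z) / (1 - z)) := by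
  have hr : 0 < r := (norm_nonneg z).trans_lt hz
  set q : ℝ := ‖z‖ / r with hq
  have hq0 : 0 ≤ q := by positivity
  have hq1 : q < 1 := (div_lt_one hr).2 hz
  have hu0 : ∀ n, 0 ≤ u n := fun n => (by positivity : 0 ≤ ‖h n 0‖ * r ^ 0).trans (hb n 0)
  have hs : Summable fun p : ℕ × ℕ => h p.1 p.2 * z ^ p.2 := by
    refine Summable.of_norm_bounded (g := fun p : ℕ × ℕ => u p.1 * q ^ p.2)
      (hu.mul_of_nonneg (summable_geometric_of_lt_one hq0 hq1) hu0 fun N => by positivity)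
      fun p => ?_
    rw [norm_mul, norm_pow]
    calc ‖h p.1 p.2‖ * ‖z‖ ^ p.2 = ‖h p.1 p.2‖ * r ^ p.2 * q ^ p.2 := by
          rw [hq, div_pow]; field_simp
      _ ≤ u p.1 * q ^ p.2 := by gcongr; exact hb _ _
  have h1 : HasSum (fun n => f n z / (1 - z)) (∑' p : ℕ × ℕ, h p.1 p.2 * z ^ p.2) :=
    hs.hasSum.prod_fiberwise fun n => hh n z (hz.trans hr1)
  have hs' := hs.prod_symm
  have h2 : HasSum (fun N => (∑' n, h n N) * z ^ N) (∑' p : ℕ × ℕ, h p.1 p.2 * z ^ p.2) := by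
    have h3 := hs'.hasSum.prod_fiberwise (fun N => (hs'.prod_factor N).hasSum)
    have h4 : ∑' p : ℕ × ℕ, h p.swap.1 p.swap.2 * z ^ p.swap.2
        = ∑' p : ℕ × ℕ, h p.1 p.2 * z ^ p.2 :=
      (Equiv.prodComm ℕ ℕ).tsum_eq fun p : ℕ × ℕ => h p.1 p.2 * z ^ p.2
    rw [h4] at h3
    refine h3.congr_fun fun N => ?_
    simp [tsum_mul_right]
  rw [← tsum_div_const, h1.tsum_eq]
  exact h2

/-! ### Graded sums and products of words -/

/-- The degree `n` part `∑_{deg w = n} ⟨S | w⟩ φ(w)` of the value of a linear functional `φ` on the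
series `S`; the words of degree `n` are listed by the finite set `F n`. -/
def gradedSum {A : Type} (F : ℕ → Finset (List A)) (φ : List A → ℂ) (S : NCSeries A) (n : ℕ) : ℂ :=
  ∑ w ∈ F n, S w * φ w

/-- If the product `p` of words is homogeneous and `φ` is a character for `p` on the words in a
class `P` that supports `S` and `T`, then the graded sums of the product of `S` and `T` are the
Cauchy products of those of `S` and `T`. -/
theorem gradedSum_extendProduct {A : Type} [DecidableEq A]
    {p : List A → List A → Multiset (List A)} {d : List A → ℕ} {F : ℕ → Finset (List A)}
    (hF : ∀ n w, w ∈ F n ↔ d w = n) (hp : ∀ u v, ∀ w ∈ p u v, d w = d u + d v)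
    {φ : List A → ℂ} {P : List A → Prop}
    (hφ : ∀ u v, P u → P v → ((p u v).map φ).sum = φ u * φ v)
    {S T : NCSeries A} (hS : ∀ w, S w ≠ 0 → P w) (hT : ∀ w, T w ≠ 0 → P w) (n : ℕ) :
    gradedSum F φ (extendProduct p S T) n =
      ∑ k ∈ Finset.HasAntidiagonal.antidiagonal n, gradedSum F φ S k.1 * gradedSum F φ T k.2 := by
  classical
  set Q : Finset (List A × List A) :=
    (Finset.HasAntidiagonal.antidiagonal n).biUnion fun k => F k.1 ×ˢ F k.2 with hQ
  have hmem : ∀ q : List A × List A, q ∈ Q ↔ d q.1 + d q.2 = n := by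
    intro q
    simp only [hQ, Finset.mem_biUnion, Finset.mem_product, hF, Finset.HasAntidiagonal.mem_antidiagonal]
    constructor
    · rintro ⟨k, hk, h1, h2⟩
      rw [h1, h2, hk]
    · exact fun h => ⟨(d q.1, d q.2), h, rfl, rfl⟩
  have h1 : ∀ w ∈ F n, extendProduct p S T w
      = ∑ q ∈ Q, S q.1 * T q.2 * ((p q.1 q.2).count w : ℂ) := by
    intro w hw
    refine finsum_eq_sum_of_support_subset _ fun q hq => ?_
    have hwq : w ∈ p q.1 q.2 := by
      by_contra h
      exact hq (by simp [Multiset.count_eq_zero_of_notMem h])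
    rw [Finset.mem_coe, hmem, ← hp _ _ w hwq]
    exact (hF n w).1 hw
  have h2 : ∀ q ∈ Q, ∑ w ∈ F n, S q.1 * T q.2 * ((p q.1 q.2).count w : ℂ) * φ w
      = S q.1 * φ q.1 * (T q.2 * φ q.2) := by
    intro q hq
    have h3 : ∑ w ∈ F n, ((p q.1 q.2).count w : ℂ) * φ w = ((p q.1 q.2).map φ).sum := by
      rw [Finset.sum_multiset_map_count]
      simp_rw [nsmul_eq_mul]
      refine (Finset.sum_subset (fun w hw => ?_) fun w _ hw => ?_).symm
      · rw [hF, hp _ _ w (Multiset.mem_toFinset.1 hw)]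
        exact (hmem q).1 hq
      · rw [Multiset.mem_toFinset] at hw
        simp [Multiset.count_eq_zero_of_notMem hw]
    simp_rw [mul_assoc (S q.1 * T q.2)]
    rw [← Finset.mul_sum, h3]
    by_cases hs : S q.1 = 0
    · simp [hs]
    by_cases ht : T q.2 = 0
    · simp [ht]
    rw [hφ _ _ (hS _ hs) (hT _ ht)]
    ring
  have hdisj : ((Finset.HasAntidiagonal.antidiagonal n : Finset (ℕ × ℕ)) : Set (ℕ × ℕ)).PairwiseDisjoint
      fun k => F k.1 ×ˢ F k.2 := by
    intro k _ l _ hkl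
    refine Finset.disjoint_left.2 fun q h h' => hkl ?_
    simp only [Finset.mem_product, hF] at h h'
    exact Prod.ext (h.1.symm.trans h'.1) (h.2.symm.trans h'.2)
  calc gradedSum F φ (extendProduct p S T) n
      = ∑ w ∈ F n, ∑ q ∈ Q, S q.1 * T q.2 * ((p q.1 q.2).count w : ℂ) * φ w :=
        Finset.sum_congr rfl fun w hw => by rw [h1 w hw, Finset.sum_mul]
    _ = ∑ q ∈ Q, S q.1 * φ q.1 * (T q.2 * φ q.2) := by
        rw [Finset.sum_comm]
        exact Finset.sum_congr rfl h2
    _ = _ := by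
        rw [hQ, Finset.sum_biUnion hdisj]
        refine Finset.sum_congr rfl fun k _ => ?_
        rw [gradedSum, gradedSum, Finset.sum_mul_sum, Finset.sum_product]

/-- The words of length `n` over `X`. -/
def lengthFinset (n : ℕ) : Finset (List X) :=
  Finset.univ.map ⟨fun w : Fin n → X => List.ofFn w, List.ofFn_injective⟩

theorem mem_lengthFinset (n : ℕ) (w : List X) : w ∈ lengthFinset n ↔ w.length = n := by
  simp only [lengthFinset, Finset.mem_map, Finset.mem_univ, true_and, Function.Embedding.coeFn_mk]
  constructor
  · rintro ⟨f, rfl⟩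
    simp
  · rintro rfl
    exact ⟨w.get, List.ofFn_get w⟩

/-- The words of weight `n` over `Y`. -/
def weightFinset (n : ℕ) : Finset (List ℕ+) :=
  ((finite_weight_le n).subset (fun _ h => le_of_eq h : {s | weight s = n} ⊆ _)).toFinset

theorem mem_weightFinset (n : ℕ) (v : List ℕ+) : v ∈ weightFinset n ↔ weight v = n := by
  simp [weightFinset]

theorem weight_cons (s : ℕ+) (l : List ℕ+) : weight (s :: l) = s + weight l := by
  simp [weight]

theorem length_piXWord (v : List ℕ+) : (piXWord v).length = weight v := by
  induction v with
  | nil => rfl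
  | cons s l ih =>
    have := s.natPred_add_one
    simp only [piXWord, List.length_append, List.length_replicate, List.length_cons, ih,
      weight_cons]
    omega

theorem LiComponent_eq_gradedSum (S : NCSeries X) (n : ℕ) (z : ℂ) :
    LiComponent S n z = gradedSum lengthFinset (fun w => LiWord w z) S n := by
  simp [LiComponent, gradedSum, lengthFinset]

theorem LiWord_piXWord (v : List ℕ+) : LiWord (piXWord v) = polylog v :=
  piXWord_injective.extend_apply _ _ _

theorem piX_mem_endsInX1 (Q : NCSeries ℕ+) : piX Q ∈ endsInX1 := by
  intro w hw
  rw [← mem_range_piXWord]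
  by_contra h
  exact hw (by rw [piX, Function.extend_apply' _ _ _ h]; rfl)

theorem piX_apply_piXWord (Q : NCSeries ℕ+) (v : List ℕ+) : piX Q (piXWord v) = Q v :=
  piXWord_injective.extend_apply _ _ _

theorem LiComponent_piX (Q : NCSeries ℕ+) (n : ℕ) (z : ℂ) :
    LiComponent (piX Q) n z = gradedSum weightFinset (fun v => polylog v z) Q n := by
  rw [LiComponent_eq_gradedSum]
  symm
  refine Finset.sum_of_injOn piXWord piXWord_injective.injOn (fun v hv => ?_)
    (fun w _ hw => ?_) fun v _ => ?_
  · simpa [mem_lengthFinset, length_piXWord, mem_weightFinset] using hv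
  · by_contra h
    obtain ⟨v, rfl⟩ := (mem_range_piXWord w).2
      (piX_mem_endsInX1 Q w fun h0 => h (by simp [h0]))
    refine hw ⟨v, ?_, rfl⟩
    simp_all [mem_lengthFinset, length_piXWord, mem_weightFinset]
  · simp only [piX_apply_piXWord, LiWord_piXWord]

/-! ### Harmonic sums are stuffle characters -/

theorem harmonicSum_cons_succ (s : ℕ+) (l : List ℕ+) (N : ℕ) :
    harmonicSum (s :: l) (N + 1) =
      harmonicSum (s :: l) N + 1 / ((N : ℂ) + 1) ^ (s : ℕ) * harmonicSum l N := by
  simp [harmonicSum, Finset.sum_range_succ]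

theorem sum_map_range {α : Type*} (m : Multiset α) (c : ℕ → ℂ) (φ : α → ℕ → ℂ) (N : ℕ) :
    (m.map fun w => ∑ n ∈ Finset.range N, c n * φ w n).sum =
      ∑ n ∈ Finset.range N, c n * (m.map fun w => φ w n).sum := by
  rw [Multiset.sum_map_sum]
  simp_rw [Multiset.sum_map_mul_left]

/-- The three terms of the stuffle recursion are the three parts `n₁ > m₁`, `n₁ < m₁`, `n₁ = m₁` of
the product of two sums with outer indices `n₁` and `m₁`. -/
theorem sum_harmonicSum_stuffleWord (u v : List ℕ+) (N : ℕ) :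
    ((stuffleWord u v).map fun w => harmonicSum w N).sum = harmonicSum u N * harmonicSum v N := by
  induction u, v using stuffleWord.induct generalizing N with
  | case1 v => simp [stuffleWord, harmonicSum]
  | case2 s u => simp [stuffleWord, harmonicSum]
  | case3 s u t v ih1 ih2 ih3 =>
    have h : ((stuffleWord (s :: u) (t :: v)).map fun w => harmonicSum w N).sum =
        ∑ n ∈ Finset.range N, (1 / ((n : ℂ) + 1) ^ (s : ℕ) *
            (harmonicSum u n * harmonicSum (t :: v) n)
          + 1 / ((n : ℂ) + 1) ^ (t : ℕ) * (harmonicSum (s :: u) n * harmonicSum v n)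
          + 1 / ((n : ℂ) + 1) ^ ((s + t : ℕ+) : ℕ) * (harmonicSum u n * harmonicSum v n)) := by
      simp only [stuffleWord, Multiset.map_add, Multiset.map_map, Function.comp_def,
        Multiset.sum_add, harmonicSum, sum_map_range, ih1, ih2, ih3, Finset.sum_add_distrib]
    rw [h]
    clear h ih1 ih2 ih3
    induction N with
    | zero => simp [harmonicSum]
    | succ N ih =>
      rw [Finset.sum_range_succ, ih, harmonicSum_cons_succ, harmonicSum_cons_succ, PNat.add_coe,
        pow_add]
      ring

/-! ### Polylogarithms are shuffle characters -/

/-- The image of `π_X` is closed under removal of the first letter; this is what makes the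
inductions on the first letter below possible. -/
theorem mem_range_piXWord_cons (a : X) (w : List X) :
    a :: w ∈ Set.range piXWord ↔ w ∈ Set.range piXWord ∧ (w = [] → a = X.x1) := by
  simp only [mem_range_piXWord]
  constructor
  · rintro (h | ⟨_ | ⟨c, u⟩, h⟩)
    · simp at h
    · simp_all
    · obtain ⟨rfl, rfl⟩ : a = c ∧ w = u ++ [X.x1] := by simpa using h
      simp
  · rintro ⟨rfl | ⟨u, rfl⟩, h⟩
    · exact Or.inr ⟨[], by simp [h rfl]⟩
    · exact Or.inr ⟨a :: u, by simp⟩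

theorem mem_range_piXWord_of_mem_shuffleWord {u v w : List X} (hu : u ∈ Set.range piXWord)
    (hv : v ∈ Set.range piXWord) (hw : w ∈ shuffleWord u v) : w ∈ Set.range piXWord := by
  induction u, v using shuffleWord.induct generalizing w with
  | case1 v => simp_all [shuffleWord]
  | case2 a u => simp_all [shuffleWord]
  | case3 a u b v ih1 ih2 =>
    simp only [shuffleWord, Multiset.mem_add, Multiset.mem_map] at hw
    rcases hw with ⟨x, hx, rfl⟩ | ⟨x, hx, rfl⟩
    · refine (mem_range_piXWord_cons a x).2
        ⟨ih1 ((mem_range_piXWord_cons a u).1 hu).1 hv hx, fun h => ?_⟩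
      have := length_of_mem_shuffleWord _ _ _ hx
      simp [h] at this
    · refine (mem_range_piXWord_cons b x).2
        ⟨ih2 hu ((mem_range_piXWord_cons b v).1 hv).1 hx, fun h => ?_⟩
      have := length_of_mem_shuffleWord _ _ _ hx
      simp [h, Nat.add_right_comm] at this

theorem shuffle_mem_endsInX1 {S T : NCSeries X} (hS : S ∈ endsInX1) (hT : T ∈ endsInX1) :
    shuffle S T ∈ endsInX1 := by
  intro w hw
  obtain ⟨q, hq⟩ : ∃ q : List X × List X,
      S q.1 * T q.2 * ((shuffleWord q.1 q.2).count w : ℂ) ≠ 0 := by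
    by_contra! h
    exact hw (by simp [shuffle, extendProduct, h])
  simp only [ne_eq, mul_eq_zero, not_or, Nat.cast_eq_zero] at hq
  rw [← mem_range_piXWord]
  exact mem_range_piXWord_of_mem_shuffleWord ((mem_range_piXWord _).2 (hS _ hq.1.1))
    ((mem_range_piXWord _).2 (hT _ hq.1.2)) (Multiset.count_ne_zero.1 hq.2)

/-- The Taylor coefficients of `Li_w` for `w` in the image of `π_X`, defined by the recursion on the first letter that integrates
`z Li_{x₀w}' = Li_w` and `z Li_{x₁w}' = z / (1 - z) Li_w`. In degree `0` the division by `k = 0`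
gives `0`, the vanishing of `Li_w` at the origin for `w ≠ 1`. -/
def liCoeff : List X → ℕ → ℂ
  | [], k => if k = 0 then 1 else 0
  | X.x0 :: w, k => liCoeff w k / k
  | X.x1 :: w, k => (∑ j ∈ Finset.range k, liCoeff w j) / k

/-- The power series of `Li_w` at the origin, for `w` in the image of `π_X`. -/
def liSeries (w : List X) : PowerSeries ℂ := PowerSeries.mk (liCoeff w)

theorem liCoeff_cons_zero (a : X) (w : List X) : liCoeff (a :: w) 0 = 0 := by
  cases a <;> simp [liCoeff]

theorem liSeries_nil : liSeries [] = 1 := by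
  ext k
  simp [liSeries, liCoeff, PowerSeries.coeff_one]

/-- The Euler operator `z d/dz` on power series. -/
def euler : Derivation ℂ (PowerSeries ℂ) (PowerSeries ℂ) :=
  (PowerSeries.X : PowerSeries ℂ) • PowerSeries.derivative ℂ

theorem coeff_euler (f : PowerSeries ℂ) (k : ℕ) :
    PowerSeries.coeff k (euler f) = k * PowerSeries.coeff k f := by
  cases k with
  | zero => simp [euler]
  | succ k =>
    simp [euler, PowerSeries.coeff_succ_X_mul, PowerSeries.coeff_derivative, mul_comm]

theorem eq_of_euler_eq {f g : PowerSeries ℂ} (h : euler f = euler g)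
    (h0 : PowerSeries.coeff 0 f = PowerSeries.coeff 0 g) : f = g := by
  ext k
  rcases Nat.eq_zero_or_pos k with rfl | hk
  · exact h0
  · have := congrArg (PowerSeries.coeff k) h
    rw [coeff_euler, coeff_euler] at this
    exact mul_left_cancel₀ (by exact_mod_cast hk.ne') this

/-- The differential form attached to a letter: `ω(x₀) = 1`, `ω(x₁) = z / (1 - z)`, both to be
multiplied by `dz / z`. -/
def letterForm : X → PowerSeries ℂ
  | X.x0 => 1
  | X.x1 => PowerSeries.X * PowerSeries.mk 1

/-- The differential equations of the polylogarithms. A word `x₀w` in the image of `π_X` has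
`w ≠ 1`, so that `Li_w` vanishes at the origin and no constant term is lost in the division by
`k`. -/
theorem euler_liSeries_cons {a : X} {w : List X} (h : a :: w ∈ Set.range piXWord) :
    euler (liSeries (a :: w)) = letterForm a * liSeries w := by
  ext k
  rw [coeff_euler]
  rcases Nat.eq_zero_or_pos k with rfl | hk
  · cases a with
    | x0 =>
      cases w with
      | nil => exact absurd (((mem_range_piXWord_cons _ _).1 h).2 rfl) (by simp)
      | cons b w => simp [liSeries, letterForm, liCoeff_cons_zero]
    | x1 => simp [letterForm]
  · have hk' : (k : ℂ) ≠ 0 := by exact_mod_cast hk.ne'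
    cases a with
    | x0 => simp [liSeries, letterForm, liCoeff, mul_div_cancel₀ _ hk']
    | x1 =>
      -- Multiplication by `1 / (1 - z)` takes the partial sums of the coefficients.
      obtain ⟨k, rfl⟩ := Nat.exists_eq_succ_of_ne_zero hk.ne'
      rw [letterForm, mul_assoc, PowerSeries.coeff_succ_X_mul, mul_comm (PowerSeries.mk 1),
        PowerSeries.coeff_mul]
      simp only [liSeries, PowerSeries.coeff_mk, liCoeff, Pi.one_apply, mul_one,
        mul_div_cancel₀ _ hk']
      rw [Finset.Nat.sum_antidiagonal_eq_sum_range_succ_mk]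

/-- The shuffle identity at the level of power series: both sides vanish at the origin and have the
same image under the Euler operator, by the Leibniz rule. -/
theorem sum_liSeries_shuffleWord {u v : List X} (hu : u ∈ Set.range piXWord)
    (hv : v ∈ Set.range piXWord) :
    ((shuffleWord u v).map liSeries).sum = liSeries u * liSeries v := by
  induction u, v using shuffleWord.induct with
  | case1 v => simp [shuffleWord, liSeries_nil]
  | case2 a u => simp [shuffleWord, liSeries_nil]
  | case3 a u b v ih1 ih2 =>
    have e1 := ih1 ((mem_range_piXWord_cons a u).1 hu).1 hv
    have e2 := ih2 hu ((mem_range_piXWord_cons b v).1 hv).1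
    have key : ∀ (c : X) (m : Multiset (List X)),
        (∀ x ∈ m, c :: x ∈ Set.range piXWord) →
        euler ((m.map fun x => liSeries (c :: x)).sum) = letterForm c * (m.map liSeries).sum := by
      intro c m hm
      rw [map_multiset_sum, Multiset.map_map, ← Multiset.sum_map_mul_left]
      exact congrArg _ (Multiset.map_congr rfl fun x hx => euler_liSeries_cons (hm x hx))
    have hmem : ∀ x ∈ shuffleWord (a :: u) (b :: v), x ∈ Set.range piXWord :=
      fun x hx => mem_range_piXWord_of_mem_shuffleWord hu hv hx
    refine eq_of_euler_eq ?_ ?_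
    · simp only [shuffleWord, Multiset.map_add, Multiset.map_map, Function.comp_def,
        Multiset.sum_add, map_add]
      rw [key a _ fun x hx => hmem _ (by
          rw [shuffleWord]
          exact Multiset.mem_add.2 (Or.inl (Multiset.mem_map_of_mem _ hx))),
        key b _ fun x hx => hmem _ (by
          rw [shuffleWord]
          exact Multiset.mem_add.2 (Or.inr (Multiset.mem_map_of_mem _ hx))),
        e1, e2, Derivation.leibniz, euler_liSeries_cons hu, euler_liSeries_cons hv]
      simp only [smul_eq_mul]
      ring
    · simp only [shuffleWord, Multiset.map_add, Multiset.map_map, Function.comp_def,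
        Multiset.sum_add, map_add, map_multiset_sum]
      simp [liSeries, liCoeff_cons_zero]

/-! ### Taylor expansions of the polylogarithms -/

theorem liCoeff_replicate_append (m : ℕ) (w : List X) (k : ℕ) :
    liCoeff (List.replicate m X.x0 ++ w) k = liCoeff w k / (k : ℂ) ^ m := by
  induction m with
  | zero => simp
  | succ m ih => rw [List.replicate_succ, List.cons_append, liCoeff, ih, pow_succ, div_div]

theorem liCoeff_piXWord_cons (s : ℕ+) (l : List ℕ+) (k : ℕ) :
    liCoeff (piXWord (s :: l)) k =
      (∑ j ∈ Finset.range k, liCoeff (piXWord l) j) / (k : ℂ) ^ (s : ℕ) := by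
  rw [piXWord, liCoeff_replicate_append, liCoeff, div_div, ← pow_succ', s.natPred_add_one]

/-- The harmonic sums are the Taylor coefficients of `Li_v(z) / (1 - z)`. -/
theorem sum_liCoeff_piXWord (v : List ℕ+) (N : ℕ) :
    ∑ j ∈ Finset.range (N + 1), liCoeff (piXWord v) j = harmonicSum v N := by
  induction v generalizing N with
  | nil => simp [piXWord, liCoeff, harmonicSum]
  | cons s l ih =>
    rw [Finset.sum_range_succ', harmonicSum]
    simp only [liCoeff_piXWord_cons, ih]
    simp [div_eq_inv_mul]

theorem liCoeff_piXWord_cons_succ (s : ℕ+) (l : List ℕ+) (n : ℕ) :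
    liCoeff (piXWord (s :: l)) (n + 1) = 1 / ((n : ℂ) + 1) ^ (s : ℕ) * harmonicSum l n := by
  rw [liCoeff_piXWord_cons, sum_liCoeff_piXWord, Nat.cast_add_one, div_eq_inv_mul, one_div]

/-- A polynomial bound, enough for the convergence of the power series below on the unit disk. -/
theorem norm_harmonicSum_le (l : List ℕ+) (N : ℕ) :
    ‖harmonicSum l N‖ ≤ ((N : ℝ) + 1) ^ l.length := by
  induction l generalizing N with
  | nil => simp [harmonicSum]
  | cons s l ih =>
    have hterm : ∀ n ∈ Finset.range N,
        ‖1 / ((n : ℂ) + 1) ^ (s : ℕ) * harmonicSum l n‖ ≤ ((N : ℝ) + 1) ^ l.length := by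
      intro n hn
      have hnN : (n : ℝ) ≤ N := by exact_mod_cast (Finset.mem_range.1 hn).le
      have h1 : ‖(1 : ℂ) / ((n : ℂ) + 1) ^ (s : ℕ)‖ ≤ 1 := by
        have h2 : ‖(n : ℂ) + 1‖ = (n : ℝ) + 1 := by
          exact_mod_cast Complex.norm_natCast (n + 1)
        rw [norm_div, norm_one, norm_pow, h2]
        exact div_le_one_of_le₀ (one_le_pow₀ (by linarith [n.cast_nonneg (α := ℝ)]))
          (by positivity)
      rw [norm_mul]
      calc _ ≤ 1 * ((n : ℝ) + 1) ^ l.length :=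
            mul_le_mul h1 (ih n) (norm_nonneg _) zero_le_one
        _ ≤ ((N : ℝ) + 1) ^ l.length := by rw [one_mul]; gcongr
    calc ‖harmonicSum (s :: l) N‖ ≤ ∑ n ∈ Finset.range N, ((N : ℝ) + 1) ^ l.length :=
          norm_sum_le_of_le _ hterm
      _ = N * ((N : ℝ) + 1) ^ l.length := by simp
      _ ≤ ((N : ℝ) + 1) ^ (s :: l).length := by
          rw [List.length_cons, pow_succ']
          gcongr
          linarith

theorem summable_norm_harmonicSum (v : List ℕ+) {z : ℂ} (hz : ‖z‖ < 1) :
    Summable fun N : ℕ => ‖harmonicSum v N * z ^ N‖ := by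
  have h : Summable fun N : ℕ => ((N : ℝ) + 1) ^ v.length * ‖z‖ ^ N := by
    -- The shifted series has the ratio `‖z‖` as an extra factor, to be divided out when `z ≠ 0`.
    rcases eq_or_ne z 0 with rfl | h0
    · refine summable_of_ne_finset_zero (s := {0}) fun N hN => ?_
      rw [Finset.mem_singleton] at hN
      simp [hN]
    have h1 := (summable_nat_add_iff 1).2
      (summable_pow_mul_geometric_of_norm_lt_one v.length (r := ‖z‖) (by simpa using hz))
    refine (h1.mul_left ‖z‖⁻¹).congr fun N => ?_
    have : ‖z‖ ≠ 0 := norm_ne_zero_iff.2 h0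
    rw [pow_succ']
    push_cast
    field_simp
  refine h.of_nonneg_of_le (fun _ => norm_nonneg _) fun N => ?_
  rw [norm_mul, norm_pow]
  gcongr
  exact norm_harmonicSum_le v N

theorem liCoeff_piXWord_eq_sub (v : List ℕ+) (k : ℕ) :
    liCoeff (piXWord v) (k + 1) = harmonicSum v (k + 1) - harmonicSum v k := by
  rw [← sum_liCoeff_piXWord, ← sum_liCoeff_piXWord, Finset.sum_range_succ _ (k + 1)]
  ring

theorem summable_norm_liCoeff (v : List ℕ+) {z : ℂ} (hz : ‖z‖ < 1) :
    Summable fun k : ℕ => ‖liCoeff (piXWord v) k * z ^ k‖ := by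
  have h := summable_norm_harmonicSum v hz
  refine (summable_nat_add_iff 1).1 ?_
  refine Summable.of_nonneg_of_le (fun _ => norm_nonneg _) (fun k => ?_)
    (((summable_nat_add_iff 1).2 h).add (h.mul_left ‖z‖))
  have e : liCoeff (piXWord v) (k + 1) * z ^ (k + 1)
      = harmonicSum v (k + 1) * z ^ (k + 1) - z * (harmonicSum v k * z ^ k) := by
    rw [liCoeff_piXWord_eq_sub]
    ring
  rw [e, ← norm_mul z]
  exact norm_sub_le _ _

theorem hasSum_polylog (v : List ℕ+) {z : ℂ} (hz : ‖z‖ < 1) :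
    HasSum (fun k => liCoeff (piXWord v) k * z ^ k) (polylog v z) := by
  cases v with
  | nil =>
    have := hasSum_ite_eq 0 (1 : ℂ)
    refine this.congr_fun fun k => ?_
    by_cases hk : k = 0 <;> simp [piXWord, liCoeff, hk]
  | cons s l =>
    have h := (summable_norm_liCoeff (s :: l) hz).of_norm.hasSum
    have e : ∑' k, liCoeff (piXWord (s :: l)) k * z ^ k = polylog (s :: l) z := by
      rw [h.summable.tsum_eq_zero_add, liCoeff_piXWord_cons, Finset.range_zero, Finset.sum_empty,
        zero_div, zero_mul, zero_add, polylog]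
      refine tsum_congr fun n => ?_
      rw [liCoeff_piXWord_cons_succ]
      ring
    rwa [e] at h

/-- The Cauchy product of two absolutely convergent power series. -/
theorem hasSum_cauchyProduct {a b : ℕ → ℂ} {A B z : ℂ}
    (ha : HasSum (fun k => a k * z ^ k) A) (hb : HasSum (fun k => b k * z ^ k) B)
    (ha' : Summable fun k => ‖a k * z ^ k‖) (hb' : Summable fun k => ‖b k * z ^ k‖) :
    HasSum (fun k => (∑ p ∈ Finset.HasAntidiagonal.antidiagonal k, a p.1 * b p.2) * z ^ k)
      (A * B) := by
  have h := (summable_norm_sum_mul_antidiagonal_of_summable_norm ha' hb').of_norm.hasSum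
  rw [← tsum_mul_tsum_eq_tsum_sum_antidiagonal_of_summable_norm ha' hb', ha.tsum_eq,
    hb.tsum_eq] at h
  refine h.congr_fun fun k => ?_
  rw [Finset.sum_mul]
  refine Finset.sum_congr rfl fun p hp => ?_
  rw [← Finset.HasAntidiagonal.mem_antidiagonal.1 hp, pow_add]
  ring

theorem hasSum_polylog_div (v : List ℕ+) {z : ℂ} (hz : ‖z‖ < 1) :
    HasSum (fun N => harmonicSum v N * z ^ N) (polylog v z / (1 - z)) := by
  have hg : HasSum (fun k : ℕ => (1 : ℂ) * z ^ k) (1 - z)⁻¹ := by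
    simpa using hasSum_geometric_of_norm_lt_one hz
  have hg' : Summable fun k : ℕ => ‖(1 : ℂ) * z ^ k‖ := by
    simpa using summable_geometric_of_lt_one (norm_nonneg z) hz
  have h := hasSum_cauchyProduct (hasSum_polylog v hz) hg (summable_norm_liCoeff v hz) hg'
  rw [← div_eq_mul_inv] at h
  refine h.congr_fun fun N => ?_
  rw [← sum_liCoeff_piXWord, Finset.Nat.sum_antidiagonal_eq_sum_range_succ_mk]
  simp

theorem hasSum_LiWord {w : List X} (hw : w ∈ Set.range piXWord) {z : ℂ} (hz : ‖z‖ < 1) :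
    HasSum (fun k => PowerSeries.coeff k (liSeries w) * z ^ k) (LiWord w z) := by
  obtain ⟨v, rfl⟩ := hw
  simpa [LiWord_piXWord, liSeries] using hasSum_polylog v hz

/-- The polylogarithms are multiplicative for the shuffle product on the unit disk. -/
theorem sum_LiWord_shuffleWord {u v : List X} (hu : u ∈ Set.range piXWord)
    (hv : v ∈ Set.range piXWord) {z : ℂ} (hz : ‖z‖ < 1) :
    ((shuffleWord u v).map fun w => LiWord w z).sum = LiWord u z * LiWord v z := by
  have h1 : ∀ m : Multiset (List X), (∀ w ∈ m, w ∈ Set.range piXWord) →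
      HasSum (fun k => PowerSeries.coeff k (m.map liSeries).sum * z ^ k)
        (m.map fun w => LiWord w z).sum := by
    intro m
    induction m using Multiset.induction_on with
    | empty => simp [hasSum_zero]
    | cons w m ih =>
      intro hm
      simpa [add_mul] using (hasSum_LiWord (hm w (by simp)) hz).add
        (ih fun x hx => hm x (by simp [hx]))
  have h2 := h1 (shuffleWord u v) fun w => mem_range_piXWord_of_mem_shuffleWord hu hv
  rw [sum_liSeries_shuffleWord hu hv] at h2
  have hs : ∀ w ∈ Set.range piXWord,
      Summable fun k => ‖PowerSeries.coeff k (liSeries w) * z ^ k‖ := by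
    rintro _ ⟨l, rfl⟩
    simpa [liSeries] using summable_norm_liCoeff l hz
  have h3 := hasSum_cauchyProduct (hasSum_LiWord hu hz) (hasSum_LiWord hv hz) (hs u hu) (hs v hv)
  simp_rw [PowerSeries.coeff_mul] at h2
  exact h2.unique h3

/-! ### The domains in terms of harmonic sums -/

/-- `∑_{weight v = n} ⟨Q | v⟩ H_v(N)`, the contribution to `H_Q(N)` of the words of weight `n`. -/
def harmonicComponent (Q : NCSeries ℕ+) (n N : ℕ) : ℂ :=
  gradedSum weightFinset (fun v => harmonicSum v N) Q n

theorem hasSum_LiComponent_piX (Q : NCSeries ℕ+) (n : ℕ) {z : ℂ} (hz : ‖z‖ < 1) :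
    HasSum (fun N => harmonicComponent Q n N * z ^ N) (LiComponent (piX Q) n z / (1 - z)) := by
  rw [LiComponent_piX, gradedSum, Finset.sum_div]
  simp_rw [harmonicComponent, gradedSum, Finset.sum_mul, mul_div_assoc, mul_assoc]
  exact hasSum_sum fun v _ => (hasSum_polylog_div v hz).mul_left _

theorem differentiableOn_LiComponent_piX (Q : NCSeries ℕ+) (n : ℕ) :
    DifferentiableOn ℂ (LiComponent (piX Q) n) (Metric.ball 0 1) := by
  have h : ∀ v : List ℕ+, DifferentiableOn ℂ (polylog v) (Metric.ball 0 1) := fun v =>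
    differentiableOn_of_hasSum fun z hz => hasSum_polylog v hz
  have e : LiComponent (piX Q) n = fun z => ∑ v ∈ weightFinset n, Q v * polylog v z :=
    funext fun z => LiComponent_piX Q n z
  rw [e]
  exact DifferentiableOn.fun_sum fun v _ => (h v).const_mul _

/-- Membership of `Dom_R(Li)` in terms of harmonic sums: the form adapted to the stuffle product,
which multiplies them pointwise in `N`. -/
theorem piX_mem_DomR_iff {Q : NCSeries ℕ+} {R : ℝ} (hR : R ≤ 1) :
    piX Q ∈ DomR R ↔ ∀ r, 0 < r → r < R → ∃ u : ℕ → ℝ, Summable u ∧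
      ∀ n N, ‖harmonicComponent Q n N‖ * r ^ N ≤ u n := by
  rw [DomR, Set.mem_ofPred_eq, and_iff_right (piX_mem_endsInX1 Q)]
  exact summableLocallyUniformlyOn_ball_iff_coeff hR (differentiableOn_LiComponent_piX Q)
    fun n z hz => hasSum_LiComponent_piX Q n hz

/-- Membership of `Dom_R(Li)` as normal convergence: the form adapted to the shuffle product, which
multiplies the functions pointwise in `z`. -/
theorem mem_DomR_iff {S : NCSeries X} (hS : S ∈ endsInX1) {R : ℝ} (hR : R ≤ 1) :
    S ∈ DomR R ↔ ∀ r, 0 < r → r < R → ∃ u : ℕ → ℝ, Summable u ∧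
      ∀ n, ∀ z : ℂ, ‖z‖ ≤ r → ‖LiComponent S n z‖ ≤ u n := by
  rw [DomR, Set.mem_ofPred_eq, and_iff_right hS, ← piX_piY S hS]
  exact summableLocallyUniformlyOn_ball_iff fun n =>
    (differentiableOn_LiComponent_piX _ n).mono (Metric.ball_subset_ball hR)

theorem DomR_anti {R R' : ℝ} (h : R ≤ R') : DomR R' ⊆ DomR R :=
  fun _ hS => ⟨hS.1, hS.2.mono (Metric.ball_subset_ball h)⟩

theorem mem_DomH_iff {Q : NCSeries ℕ+} : Q ∈ DomH ↔ piX Q ∈ DomLoc := by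
  constructor
  · rintro ⟨S, hS, rfl⟩
    obtain ⟨R, h0, h1, hR⟩ := hS
    rw [piX_piY S hR.1]
    exact ⟨R, h0, h1, hR⟩
  · exact fun h => ⟨piX Q, h, piY_piX Q⟩

theorem hasSum_tsum_harmonicComponent {Q : NCSeries ℕ+} {R : ℝ} (hR : R ≤ 1)
    (hQ : piX Q ∈ DomR R) {z : ℂ} (hz : ‖z‖ < R) :
    HasSum (fun N => (∑' n, harmonicComponent Q n N) * z ^ N) (Li (piX Q) z / (1 - z)) := by
  obtain ⟨r, hzr, hrR⟩ := exists_between hz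
  obtain ⟨u, hu, hb⟩ :=
    (piX_mem_DomR_iff hR).1 hQ r ((norm_nonneg z).trans_lt hzr) hrR
  exact hasSum_tsum_coeff (hrR.trans_le hR) (fun n z hz => hasSum_LiComponent_piX Q n hz) hu hb hzr

/-- `H_Q(N)` is the sum of the contributions of the homogeneous components of `Q`. -/
theorem H_eq_tsum_harmonicComponent {Q : NCSeries ℕ+} (hQ : Q ∈ DomH) (N : ℕ) :
    H Q N = ∑' n, harmonicComponent Q n N := by
  obtain ⟨R, h0, h1, hR⟩ := mem_DomH_iff.1 hQ
  exact taylorCoeff_eq_of_hasSum h0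
    (fun z hz => hasSum_tsum_harmonicComponent h1 hR hz) N

theorem summable_norm_harmonicComponent {Q : NCSeries ℕ+} (hQ : Q ∈ DomH) (N : ℕ) :
    Summable fun n => ‖harmonicComponent Q n N‖ := by
  obtain ⟨R, h0, h1, hR⟩ := mem_DomH_iff.1 hQ
  obtain ⟨r, hr, hrR⟩ := exists_between h0
  obtain ⟨u, hu, hb⟩ := (piX_mem_DomR_iff h1).1 hR r hr hrR
  refine (hu.div_const (r ^ N)).of_nonneg_of_le (fun _ => norm_nonneg _) fun n => ?_
  rw [le_div_iff₀ (by positivity)]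
  exact hb n N

theorem hasSum_H {Q : NCSeries ℕ+} {R : ℝ} (h0 : 0 < R) (h1 : R ≤ 1) (hQ : piX Q ∈ DomR R)
    {z : ℂ} (hz : ‖z‖ < R) : HasSum (fun N => H Q N * z ^ N) (Li (piX Q) z / (1 - z)) := by
  have hD : Q ∈ DomH := mem_DomH_iff.2 ⟨R, h0, h1, hQ⟩
  simpa only [H_eq_tsum_harmonicComponent hD] using hasSum_tsum_harmonicComponent h1 hQ hz

/-! ### Stuffle products -/

theorem harmonicComponent_stuffle (P Q : NCSeries ℕ+) (n N : ℕ) :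
    harmonicComponent (stuffle P Q) n N =
      ∑ k ∈ Finset.HasAntidiagonal.antidiagonal n,
        harmonicComponent P k.1 N * harmonicComponent Q k.2 N :=
  gradedSum_extendProduct (P := fun _ => True) mem_weightFinset weight_of_mem_stuffleWord
    (fun u v _ _ => sum_harmonicSum_stuffleWord u v N) (fun _ _ => trivial) (fun _ _ => trivial) n

/-- Hadamard multiplication of coefficients bounded by `r₁ ^ (-N)` and `r₂ ^ (-N)` gives
coefficients bounded by `(r₁ r₂) ^ (-N)`. -/
theorem piX_stuffle_mem_DomR {P Q : NCSeries ℕ+} {R₁ R₂ : ℝ} (h1' : R₁ ≤ 1)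
    (h2 : 0 < R₂) (h2' : R₂ ≤ 1) (hP : piX P ∈ DomR R₁) (hQ : piX Q ∈ DomR R₂) :
    piX (stuffle P Q) ∈ DomR (R₁ * R₂) := by
  rw [piX_mem_DomR_iff (mul_le_one₀ h1' h2.le h2')]
  intro r hr hrR
  -- Choose `r₁ < R₁` and `r₂ < R₂` with `r < r₁ r₂`.
  obtain ⟨r₁, hr₁, hr₁R⟩ := exists_between ((div_lt_iff₀ h2).2 hrR)
  have hr₁0 : 0 < r₁ := (div_pos hr h2).trans hr₁
  obtain ⟨r₂, hr₂, hr₂R⟩ := exists_between ((div_lt_comm₀ h2 hr₁0).1 hr₁)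
  have hr₂0 : 0 < r₂ := (div_pos hr hr₁0).trans hr₂
  obtain ⟨u, hu, hub⟩ := (piX_mem_DomR_iff h1').1 hP r₁ hr₁0 hr₁R
  obtain ⟨v, hv, hvb⟩ := (piX_mem_DomR_iff h2').1 hQ r₂ hr₂0 hr₂R
  have hu0 : ∀ n, 0 ≤ u n := fun n =>
    (by positivity : 0 ≤ ‖harmonicComponent P n 0‖ * r₁ ^ 0).trans (hub n 0)
  have hv0 : ∀ n, 0 ≤ v n := fun n =>
    (by positivity : 0 ≤ ‖harmonicComponent Q n 0‖ * r₂ ^ 0).trans (hvb n 0)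
  refine ⟨fun n => ∑ k ∈ Finset.HasAntidiagonal.antidiagonal n, u k.1 * v k.2,
    summable_sum_mul_antidiagonal_of_summable_mul (hu.mul_of_nonneg hv hu0 hv0), fun n N => ?_⟩
  have hle : r ≤ r₁ * r₂ := ((div_lt_iff₀' hr₁0).1 hr₂).le
  calc ‖harmonicComponent (stuffle P Q) n N‖ * r ^ N
      ≤ (∑ k ∈ Finset.HasAntidiagonal.antidiagonal n,
          ‖harmonicComponent P k.1 N‖ * ‖harmonicComponent Q k.2 N‖) * (r₁ * r₂) ^ N := by
        rw [harmonicComponent_stuffle]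
        gcongr
        exact norm_sum_le_of_le _ fun k _ => (norm_mul _ _).le
    _ = ∑ k ∈ Finset.HasAntidiagonal.antidiagonal n, ‖harmonicComponent P k.1 N‖ * r₁ ^ N *
          (‖harmonicComponent Q k.2 N‖ * r₂ ^ N) := by
        rw [Finset.sum_mul]
        refine Finset.sum_congr rfl fun k _ => ?_
        rw [mul_pow]
        ring
    _ ≤ ∑ k ∈ Finset.HasAntidiagonal.antidiagonal n, u k.1 * v k.2 := by
        refine Finset.sum_le_sum fun k _ => ?_
        exact mul_le_mul (hub _ _) (hvb _ _) (by positivity) (hu0 _)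

theorem stuffle_mem_DomH {P Q : NCSeries ℕ+} (hP : P ∈ DomH) (hQ : Q ∈ DomH) :
    stuffle P Q ∈ DomH := by
  obtain ⟨R₁, h1, h1', hP⟩ := mem_DomH_iff.1 hP
  obtain ⟨R₂, h2, h2', hQ⟩ := mem_DomH_iff.1 hQ
  exact mem_DomH_iff.2 ⟨R₁ * R₂, mul_pos h1 h2, mul_le_one₀ h1' h2.le h2',
    piX_stuffle_mem_DomR h1' h2 h2' hP hQ⟩

theorem H_stuffle {P Q : NCSeries ℕ+} (hP : P ∈ DomH) (hQ : Q ∈ DomH) (N : ℕ) :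
    H (stuffle P Q) N = H P N * H Q N := by
  rw [H_eq_tsum_harmonicComponent hP, H_eq_tsum_harmonicComponent hQ,
    H_eq_tsum_harmonicComponent (stuffle_mem_DomH hP hQ),
    tsum_mul_tsum_eq_tsum_sum_antidiagonal_of_summable_norm
      (summable_norm_harmonicComponent hP N) (summable_norm_harmonicComponent hQ N)]
  exact tsum_congr fun n => harmonicComponent_stuffle P Q n N

/-! ### Shuffle products -/

theorem LiComponent_shuffle {S T : NCSeries X} (hS : S ∈ endsInX1) (hT : T ∈ endsInX1) (n : ℕ)
    {z : ℂ} (hz : ‖z‖ < 1) :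
    LiComponent (shuffle S T) n z =
      ∑ k ∈ Finset.HasAntidiagonal.antidiagonal n, LiComponent S k.1 z * LiComponent T k.2 z := by
  simp only [LiComponent_eq_gradedSum]
  exact gradedSum_extendProduct mem_lengthFinset length_of_mem_shuffleWord
    (fun u v hu hv => sum_LiWord_shuffleWord hu hv hz)
    (fun w hw => (mem_range_piXWord w).2 (hS w hw))
    (fun w hw => (mem_range_piXWord w).2 (hT w hw)) n

theorem shuffle_mem_DomR {S T : NCSeries X} {R : ℝ} (hR : R ≤ 1) (hS : S ∈ DomR R)
    (hT : T ∈ DomR R) : shuffle S T ∈ DomR R := by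
  rw [mem_DomR_iff (shuffle_mem_endsInX1 hS.1 hT.1) hR]
  intro r hr hrR
  obtain ⟨u, hu, hub⟩ := (mem_DomR_iff hS.1 hR).1 hS r hr hrR
  obtain ⟨v, hv, hvb⟩ := (mem_DomR_iff hT.1 hR).1 hT r hr hrR
  have h0 : ‖(0 : ℂ)‖ ≤ r := by simpa using hr.le
  have hu0 : ∀ n, 0 ≤ u n := fun n => (norm_nonneg _).trans (hub n 0 h0)
  have hv0 : ∀ n, 0 ≤ v n := fun n => (norm_nonneg _).trans (hvb n 0 h0)
  refine ⟨fun n => ∑ k ∈ Finset.HasAntidiagonal.antidiagonal n, u k.1 * v k.2,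
    summable_sum_mul_antidiagonal_of_summable_mul (hu.mul_of_nonneg hv hu0 hv0),
    fun n z hz => ?_⟩
  rw [LiComponent_shuffle hS.1 hT.1 n (hz.trans_lt (hrR.trans_le hR))]
  refine norm_sum_le_of_le _ fun k _ => ?_
  rw [norm_mul]
  exact mul_le_mul (hub _ _ hz) (hvb _ _ hz) (norm_nonneg _) (hu0 _)

theorem summable_norm_LiComponent {S : NCSeries X} {R : ℝ} (hR : R ≤ 1) (hS : S ∈ DomR R)
    {z : ℂ} (hz : ‖z‖ < R) : Summable fun n => ‖LiComponent S n z‖ := by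
  obtain ⟨r, hzr, hrR⟩ := exists_between hz
  obtain ⟨u, hu, hub⟩ :=
    (mem_DomR_iff hS.1 hR).1 hS r ((norm_nonneg z).trans_lt hzr) hrR
  exact hu.of_nonneg_of_le (fun _ => norm_nonneg _) fun n => hub n z hzr.le

theorem Li_shuffle {S T : NCSeries X} {R₁ R₂ : ℝ} (h1 : R₁ ≤ 1) (h2 : R₂ ≤ 1) (hS : S ∈ DomR R₁)
    (hT : T ∈ DomR R₂) {z : ℂ} (hz : ‖z‖ < min R₁ R₂) :
    Li (shuffle S T) z = Li S z * Li T z := by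
  obtain ⟨hz1, hz2⟩ := lt_min_iff.1 hz
  rw [Li, Li, Li, tsum_mul_tsum_eq_tsum_sum_antidiagonal_of_summable_norm
    (summable_norm_LiComponent h1 hS hz1) (summable_norm_LiComponent h2 hT hz2)]
  exact tsum_congr fun n => LiComponent_shuffle hS.1 hT.1 n (hz1.trans_le h1)

/-! ### The unit and the linear structure -/

theorem piX_emptyWord : piX (emptyWord ℕ+) = emptyWord X := by
  funext w
  by_cases h : w ∈ Set.range piXWord
  · obtain ⟨v, rfl⟩ := h
    rw [piX_apply_piXWord]
    have : piXWord v = [] ↔ v = [] :=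
      ⟨fun h => piXWord_injective (h.trans rfl), fun h => by rw [h]; rfl⟩
    simp [emptyWord, Pi.single_apply, this]
  · rw [piX, Function.extend_apply' _ _ _ h]
    have : w ≠ [] := fun h0 => h ⟨[], h0.symm⟩
    simp [emptyWord, this]

theorem gradedSum_emptyWord {φ : List ℕ+ → ℂ} (n : ℕ) :
    gradedSum weightFinset φ (emptyWord ℕ+) n = if n = 0 then φ [] else 0 := by
  have h : (0 = n) = (n = 0) := propext eq_comm
  simp [gradedSum, emptyWord, Pi.single_apply, mem_weightFinset, weight, h]

theorem Li_emptyWord (z : ℂ) : Li (emptyWord X) z = 1 := by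
  simp only [Li, ← piX_emptyWord, LiComponent_piX, gradedSum_emptyWord, polylog]
  exact tsum_ite_eq 0 _

theorem harmonicComponent_emptyWord (n N : ℕ) :
    harmonicComponent (emptyWord ℕ+) n N = if n = 0 then 1 else 0 := by
  rw [harmonicComponent, gradedSum_emptyWord]
  rfl

theorem emptyWord_mem_DomLoc : emptyWord X ∈ DomLoc := by
  refine ⟨1, one_pos, le_rfl, ?_⟩
  rw [← piX_emptyWord, piX_mem_DomR_iff le_rfl]
  refine fun r hr hr1 => ⟨fun n => if n = 0 then 1 else 0, (hasSum_ite_eq 0 1).summable,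
    fun n N => ?_⟩
  rw [harmonicComponent_emptyWord]
  by_cases hn : n = 0
  · simpa [hn] using pow_le_one₀ hr.le hr1.le
  · simp [hn]

theorem emptyWord_mem_DomH : emptyWord ℕ+ ∈ DomH :=
  mem_DomH_iff.2 (by rw [piX_emptyWord]; exact emptyWord_mem_DomLoc)

theorem H_emptyWord : H (emptyWord ℕ+) = 1 := by
  funext N
  rw [H_eq_tsum_harmonicComponent emptyWord_mem_DomH]
  simp only [harmonicComponent_emptyWord]
  exact tsum_ite_eq 0 _

theorem harmonicComponent_add (P Q : NCSeries ℕ+) (n N : ℕ) :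
    harmonicComponent (P + Q) n N = harmonicComponent P n N + harmonicComponent Q n N := by
  simp [harmonicComponent, gradedSum, add_mul, Finset.sum_add_distrib]

theorem harmonicComponent_smul (c : ℂ) (Q : NCSeries ℕ+) (n N : ℕ) :
    harmonicComponent (c • Q) n N = c * harmonicComponent Q n N := by
  simp [harmonicComponent, gradedSum, mul_assoc, Finset.mul_sum]

theorem add_mem_DomH {P Q : NCSeries ℕ+} (hP : P ∈ DomH) (hQ : Q ∈ DomH) : P + Q ∈ DomH := by
  obtain ⟨R₁, h1, h1', hP⟩ := mem_DomH_iff.1 hP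
  obtain ⟨R₂, h2, h2', hQ⟩ := mem_DomH_iff.1 hQ
  refine mem_DomH_iff.2 ⟨min R₁ R₂, lt_min h1 h2, (min_le_left _ _).trans h1', ?_⟩
  rw [piX_mem_DomR_iff ((min_le_left _ _).trans h1')]
  intro r hr hrR
  obtain ⟨hr1, hr2⟩ := lt_min_iff.1 hrR
  obtain ⟨u, hu, hub⟩ := (piX_mem_DomR_iff h1').1 hP r hr hr1
  obtain ⟨v, hv, hvb⟩ := (piX_mem_DomR_iff h2').1 hQ r hr hr2
  refine ⟨fun n => u n + v n, hu.add hv, fun n N => ?_⟩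
  rw [harmonicComponent_add]
  calc _ ≤ (‖harmonicComponent P n N‖ + ‖harmonicComponent Q n N‖) * r ^ N := by
        gcongr
        exact norm_add_le _ _
    _ ≤ u n + v n := by
        rw [add_mul]
        exact add_le_add (hub n N) (hvb n N)

theorem smul_mem_DomH (c : ℂ) {Q : NCSeries ℕ+} (hQ : Q ∈ DomH) : c • Q ∈ DomH := by
  obtain ⟨R, h0, h1, hQ⟩ := mem_DomH_iff.1 hQ
  refine mem_DomH_iff.2 ⟨R, h0, h1, (piX_mem_DomR_iff h1).2 fun r hr hrR => ?_⟩
  obtain ⟨u, hu, hub⟩ := (piX_mem_DomR_iff h1).1 hQ r hr hrR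
  refine ⟨fun n => ‖c‖ * u n, hu.mul_left _, fun n N => ?_⟩
  rw [harmonicComponent_smul, norm_mul, mul_assoc]
  exact mul_le_mul_of_nonneg_left (hub n N) (norm_nonneg c)

/-- `Dom(H)` as a linear subspace of `ℂ⟨⟨Y⟩⟩`. -/
def domHSubmodule : Submodule ℂ (NCSeries ℕ+) where
  carrier := DomH
  add_mem' := add_mem_DomH
  zero_mem' := by simpa using smul_mem_DomH 0 emptyWord_mem_DomH
  smul_mem' c _ := smul_mem_DomH c

/-- `Q ↦ H_Q` as a linear map on `Dom(H)`. -/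
def harmonicLinearMap : domHSubmodule →ₗ[ℂ] (ℕ → ℂ) where
  toFun Q := H Q
  map_add' P Q := by
    funext N
    rw [Pi.add_apply, H_eq_tsum_harmonicComponent P.2, H_eq_tsum_harmonicComponent Q.2,
      H_eq_tsum_harmonicComponent (P + Q).2,
      ← (summable_norm_harmonicComponent P.2 N).of_norm.tsum_add
        (summable_norm_harmonicComponent Q.2 N).of_norm]
    exact tsum_congr fun n => harmonicComponent_add P Q n N
  map_smul' c Q := by
    funext N
    rw [Pi.smul_apply, RingHom.id_apply, H_eq_tsum_harmonicComponent Q.2,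
      H_eq_tsum_harmonicComponent (c • Q).2, smul_eq_mul, ← tsum_mul_left]
    exact tsum_congr fun n => harmonicComponent_smul c Q n N

end LocalPolylog

end

theorem theorem2 :
    -- the unit
    (emptyWord X ∈ DomLoc ∧ ∀ z : ℂ, Li (emptyWord X) z = 1) ∧
    -- stability of the domain, and multiplicativity of `H`
    (∀ S ∈ DomLoc, ∀ T ∈ DomLoc,
      shuffle S T ∈ DomLoc ∧
      piX (stuffle (piY S) (piY T)) ∈ DomLoc ∧
      ∀ N : ℕ, H (stuffle (piY S) (piY T)) N = H (piY S) N * H (piY T) N) ∧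
    -- identities between functions, on explicit disks
    (∀ R₁ R₂ : ℝ, 0 < R₁ → R₁ ≤ 1 → 0 < R₂ → R₂ ≤ 1 → ∀ S ∈ DomR R₁, ∀ T ∈ DomR R₂,
      (∀ z : ℂ, ‖z‖ < R₁ → HasSum (fun N : ℕ => H (piY S) N * z ^ N) (Li S z / (1 - z))) ∧
      (∀ z : ℂ, ‖z‖ < min R₁ R₂ → Li (shuffle S T) z = Li S z * Li T z) ∧
      (∀ z : ℂ, ‖z‖ < R₁ * R₂ →
        HasSum
          (fun N : ℕ => taylorCoeff (fun x => Li S x / (1 - x)) N *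
            taylorCoeff (fun x => Li T x / (1 - x)) N * z ^ N)
          (Li (piX (stuffle (piY S) (piY T))) z / (1 - z)))) ∧
    -- `Dom(H)` is a unital stuffle subalgebra, and `H` is a stuffle character on it
    (∃ (D : Submodule ℂ (NCSeries ℕ+)) (h : D →ₗ[ℂ] (ℕ → ℂ)),
      (D : Set (NCSeries ℕ+)) = DomH ∧
      (∀ Q : D, h Q = H (Q : NCSeries ℕ+)) ∧
      emptyWord ℕ+ ∈ D ∧ H (emptyWord ℕ+) = 1 ∧
      ∀ P ∈ D, ∀ Q ∈ D, stuffle P Q ∈ D ∧ H (stuffle P Q) = H P * H Q) := by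
  refine ⟨⟨emptyWord_mem_DomLoc, Li_emptyWord⟩, fun S hS T hT => ?_,
    fun R₁ R₂ h1 h1' h2 h2' S hS T hT => ?_,
    domHSubmodule, harmonicLinearMap, rfl, fun _ => rfl, emptyWord_mem_DomH, H_emptyWord,
    fun P hP Q hQ => ⟨stuffle_mem_DomH hP hQ, funext (H_stuffle hP hQ)⟩⟩
  · have hS' : piY S ∈ DomH := ⟨S, hS, rfl⟩
    have hT' : piY T ∈ DomH := ⟨T, hT, rfl⟩
    refine ⟨?_, mem_DomH_iff.1 (stuffle_mem_DomH hS' hT'), H_stuffle hS' hT'⟩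
    obtain ⟨R₁, h1, h1', hS⟩ := hS
    obtain ⟨R₂, h2, -, hT⟩ := hT
    have hR : min R₁ R₂ ≤ 1 := (min_le_left _ _).trans h1'
    exact ⟨min R₁ R₂, lt_min h1 h2, hR, shuffle_mem_DomR hR
      (DomR_anti (min_le_left _ _) hS) (DomR_anti (min_le_right _ _) hT)⟩
  · have eS := piX_piY S hS.1
    have eT := piX_piY T hT.1
    have hS' : piX (piY S) ∈ DomR R₁ := by rwa [eS]
    have hT' : piX (piY T) ∈ DomR R₂ := by rwa [eT]
    have hDS : piY S ∈ DomH := ⟨S, ⟨R₁, h1, h1', hS⟩, rfl⟩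
    have hDT : piY T ∈ DomH := ⟨T, ⟨R₂, h2, h2', hT⟩, rfl⟩
    refine ⟨fun z hz => ?_, fun z hz => Li_shuffle h1' h2' hS hT hz, fun z hz => ?_⟩
    · simpa only [eS] using hasSum_H h1 h1' hS' hz
    · have h := hasSum_H (mul_pos h1 h2) (mul_le_one₀ h1' h2.le h2')
        (piX_stuffle_mem_DomR h1' h2 h2' hS' hT') hz
      refine h.congr_fun fun N => ?_
      rw [H_stuffle hDS hDT, H, H, eS, eT]
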